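/- Let $X$ be a finite set with $n$ elements, and let $(X,S)$ be a non-degenerate symmetric set-theoretical solution of the quantum Yang-Baxter equation: writing $S(x,y)=(g_x(y),f_y(x))$, the map $S:X\times X\to X\times X$ satisfies $S\circ S=\mathrm{Id}$ and $S^{12}S^{23}S^{12}=S^{23}S^{12}S^{23}$ on $X^3$ (where $S^{i\,i+1}$ is $S$ acting on the $i$th and $(i+1)$th components), and all maps $f_x,g_x:X\to X$ are bijective. Let $$G(X,S)=\langle X\mid xy=g_x(y)f_y(x)\ ;\ x,y\in X,\ S(x,y)\neq(x,y)\rangle$$ be its structure group. A pair $(x,y)\in X\times X$ is called frozen if $S(x,y)=(x,y)$; the element $xy$ of $G(X,S)$ is then called a frozen element. Let $V$ be a real vector space with basis $X$. For $x\in X$ put $\phi_x=f_x^{-1}$, and let $\psi_x\in GL(V)$ be defined by $\psi_x(y)=\phi_x(y)$ for $y\in X$, $y\neq x$, and $\psi_x(x)=-\phi_x(x)$. The map $x\mapsto\psi_x$ extends to a group morphism $\psi:G(X,S)\to GL(V)$; let $W(X,S)$ be its image and $N(X,S)$ its kernel. Assume that $(X,S)$ verifies Property $(\mathcal C)$: for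 every frozen pair $(x,y)$ one has $g_x\circ g_y=\mathrm{Id}_X$ and $f_y\circ f_x=\mathrm{Id}_X$. Then: 1. $N(X,S)$ is equal to the subgroup of $G(X,S)$ generated by the frozen elements. 2. There are exactly $n$ frozen elements in $G(X,S)$, and the subgroup that they generate is a free abelian group, freely generated by the frozen elements. In particular it is free abelian of rank $n$. 3. Consequently there is an exact sequence $$1\to N(X,S)\to G(X,S)\xrightarrow{\ \psi\ } W(X,S)\to 1$$ where $N(X,S)$ is a free abelian group of rank $n$. -/

import Mathlib

namespace YangBaxter

/-- The map `S¹²` on `X³`: apply `S` to the first two components. -/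
def map12 {X : Type*} (S : X × X → X × X) : X × X × X → X × X × X :=
  fun p => ((S (p.1, p.2.1)).1, (S (p.1, p.2.1)).2, p.2.2)

/-- The map `S²³` on `X³`: apply `S` to the last two components. -/
def map23 {X : Type*} (S : X × X → X × X) : X × X × X → X × X × X :=
  fun p => (p.1, S p.2)

/-- The map `g_x`, where `S (x, y) = (g_x y, f_y x)`. -/
def gMap {X : Type*} (S : X × X → X × X) (x : X) : X → X := fun y => (S (x, y)).1

/-- The map `f_y`, where `S (x, y) = (g_x y, f_y x)`. -/
def fMap {X : Type*} (S : X × X → X × X) (y : X) : X → X := fun x => (S (x, y)).2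

/-- A non-degenerate symmetric (that is, involutive and braided) set-theoretical solution
`(X, S)` of the quantum Yang-Baxter equation. -/
structure Solution (X : Type*) where
  /-- The underlying map. -/
  S : X × X → X × X
  /-- Non-degeneracy: all maps `g_x` are bijective. -/
  bijective_g : ∀ x, Function.Bijective (gMap S x)
  /-- Non-degeneracy: all maps `f_x` are bijective. -/
  bijective_f : ∀ x, Function.Bijective (fMap S x)
  /-- `S ∘ S = id`. -/
  involutive : S ∘ S = id
  /-- `S¹² S²³ S¹² = S²³ S¹² S²³`. -/
  braided : map12 S ∘ map23 S ∘ map12 S = map23 S ∘ map12 S ∘ map23 S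

namespace Solution

variable {X : Type*}

/-- The pair `(x, y)` is frozen: `S (x, y) = (x, y)`. -/
def IsFrozen (s : Solution X) (x y : X) : Prop := s.S (x, y) = (x, y)

/-- Property (C): `g_x ∘ g_y = id` and `f_y ∘ f_x = id` for every frozen pair `(x, y)`. -/
def PropertyC (s : Solution X) : Prop :=
  ∀ x y, s.IsFrozen x y →
    gMap s.S x ∘ gMap s.S y = id ∧ fMap s.S y ∘ fMap s.S x = id

/-- The relators `x y (g_x(y) f_y(x))⁻¹`, for the pairs `(x, y)` with `S (x, y) ≠ (x, y)`. -/
def relators (s : Solution X) : Set (FreeGroup X) :=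
  {r | ∃ x y : X, s.S (x, y) ≠ (x, y) ∧
    r = FreeGroup.of x * FreeGroup.of y *
      (FreeGroup.of (gMap s.S x y) * FreeGroup.of (fMap s.S y x))⁻¹}

/-- The structure group `G(X, S) = ⟨X ∣ x y = g_x(y) f_y(x), S (x, y) ≠ (x, y)⟩`. -/
abbrev StructureGroup (s : Solution X) : Type _ := PresentedGroup s.relators

/-- The generator of the structure group given by `x : X`. -/
def gen (s : Solution X) (x : X) : s.StructureGroup := PresentedGroup.of x

/-- The frozen elements of the structure group: the products `x y`, for `(x, y)` frozen. -/
def frozenElements (s : Solution X) : Set s.StructureGroup :=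
  {a | ∃ x y : X, s.IsFrozen x y ∧ a = s.gen x * s.gen y}

/-- The frozen subgroup: the subgroup of the structure group generated by the frozen elements. -/
def frozenSubgroup (s : Solution X) : Subgroup s.StructureGroup :=
  Subgroup.closure s.frozenElements

/-- The permutation `φ_x = f_x⁻¹` of `X`. -/
noncomputable def phi (s : Solution X) (x : X) : Equiv.Perm X :=
  (Equiv.ofBijective (fMap s.S x) (s.bijective_f x)).symm

variable {V : Type*} [AddCommGroup V] [Module ℝ V]

open Classical in
/-- For a real vector space `V` with basis `X`, the linear automorphism `ψ_x` of `V`: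
`ψ_x y = φ_x y` for `y ≠ x`, and `ψ_x x = - φ_x x` (see `psiGen_apply`). -/
noncomputable def psiGen (s : Solution X) (b : Module.Basis X ℝ V) (x : X) : V ≃ₗ[ℝ] V :=
  b.equiv ((b.reindex (s.phi x).symm).unitsSMul fun y => if y = x then -1 else 1)
    (Equiv.refl X)

open Classical in
theorem psiGen_apply (s : Solution X) (b : Module.Basis X ℝ V) (x y : X) :
    s.psiGen b x (b y) = if y = x then -b (s.phi x y) else b (s.phi x y) := by
  unfold psiGen
  rw [Module.Basis.equiv_apply]
  split_ifs with h <;> simp [Module.Basis.unitsSMul_apply, h]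

theorem S_S (s : Solution X) (p : X × X) : s.S (s.S p) = p :=
  congrFun s.involutive p

theorem f_comp_f (s : Solution X) (x y a : X) :
    fMap s.S y (fMap s.S x a) =
      fMap s.S (fMap s.S y x) (fMap s.S (gMap s.S x y) a) := by
  have h := congrArg (fun p : X × X × X => p.2.2) (congrFun s.braided (a, x, y))
  simpa [map12, map23, fMap, gMap] using h

theorem f_phi (s : Solution X) (x y : X) : fMap s.S x (s.phi x y) = y :=
  (Equiv.ofBijective (fMap s.S x) (s.bijective_f x)).apply_symm_apply y

theorem phi_f (s : Solution X) (x y : X) : s.phi x (fMap s.S x y) = y :=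
  (Equiv.ofBijective (fMap s.S x) (s.bijective_f x)).symm_apply_apply y

theorem phi_comp_phi (s : Solution X) (x y z : X) :
    s.phi x (s.phi y z) = s.phi (gMap s.S x y) (s.phi (fMap s.S y x) z) := by
  apply (s.bijective_f x).1
  apply (s.bijective_f y).1
  rw [s.f_comp_f x y (s.phi (gMap s.S x y) _)]
  simp only [f_phi]

theorem phi_eq_iff (s : Solution X) (x y z : X) : s.phi y z = x ↔ z = fMap s.S y x := by
  constructor
  · rintro rfl
    rw [f_phi]
  · rintro rfl
    rw [phi_f]

theorem psiGen_mul_psiGen (s : Solution X) (b : Module.Basis X ℝ V) (x y : X) :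
    s.psiGen b x * s.psiGen b y =
      s.psiGen b (gMap s.S x y) * s.psiGen b (fMap s.S y x) := by
  classical
  have hy : fMap s.S (fMap s.S y x) (gMap s.S x y) = y :=
    congrArg Prod.snd (s.S_S (x, y))
  apply LinearEquiv.toLinearMap_injective
  refine b.ext fun z => ?_
  rw [LinearEquiv.coe_coe, LinearEquiv.coe_coe, LinearEquiv.mul_apply, LinearEquiv.mul_apply,
    psiGen_apply, psiGen_apply]
  split_ifs with h1 h2 h2 <;>
    simp only [map_neg, psiGen_apply, phi_eq_iff, hy, s.phi_comp_phi x y] <;>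
    simp_all

/-- The representation `ψ` of the structure group in `GL(V)`, sending each `x : X` to `ψ_x`. -/
noncomputable def psi (s : Solution X) (b : Module.Basis X ℝ V) :
    s.StructureGroup →* (V ≃ₗ[ℝ] V) :=
  PresentedGroup.toGroup (f := s.psiGen b) (by
    rintro r ⟨x, y, -, rfl⟩
    simp only [map_mul, map_inv, FreeGroup.lift_apply_of]
    rw [psiGen_mul_psiGen, mul_inv_cancel])

theorem psi_gen (s : Solution X) (b : Module.Basis X ℝ V) (x : X) :
    s.psi b (s.gen x) = s.psiGen b x :=
  PresentedGroup.toGroup.of _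

/-- The group `W(X, S)`: the image of `ψ` in `GL(V)`. -/
noncomputable abbrev W (s : Solution X) (b : Module.Basis X ℝ V) : Subgroup (V ≃ₗ[ℝ] V) :=
  (s.psi b).range

/-- The surjective morphism `ψ : G(X, S) → W(X, S)`. -/
noncomputable def psiW (s : Solution X) (b : Module.Basis X ℝ V) :
    s.StructureGroup →* s.W b :=
  (s.psi b).rangeRestrict

/-- The normal subgroup `N(X, S)`: the kernel of `ψ : G(X, S) → W(X, S)`. -/
noncomputable def N (s : Solution X) (b : Module.Basis X ℝ V) : Subgroup s.StructureGroup :=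
  (s.psiW b).ker

end Solution

end YangBaxter

/-!
The structure group `G` acts on `ℤ^X` by affine transformations, `x` acting as
`v ↦ φ_x v + e_{φ_x x}`. The translation part is a 1-cocycle `π : G → ℤ^X`, and it is injective:
the pairwise commuting maps `g ↦ g x` of `G`, where `x` depends on `g` in such a way that
`π (g x) = π g + e_y`, lift the translations of `ℤ^X` to `G`, and applying the lift of the
translation by `π g` to `1` gives back `g`. Hence `G` embeds into the group of affine
transformations.

On a basis vector, `ψ g` is the permutation given by the linear part of `g`, up to the sign
`(-1) ^ π g`. So the kernel of `ψ` consists of the elements that act as translations by vectors of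
`2 ℤ^X`. Under Property (C), the frozen elements are the elements that act as the translations by
the vectors `2 e_y`, and these translations freely generate `2 ℤ^X`.
-/

namespace YangBaxter

section CommutingFamily

variable {ι G : Type*} [Group G]

open scoped IsMulCommutative in
/-- The morphism from the free abelian group on `ι`, encoded as `ι →₀ ℤ`, to a group `G` that
extends a family of pairwise commuting elements of `G`. -/
noncomputable def commutingLift (t : ι → G) (ht : ∀ i j, Commute (t i) (t j)) :
    Multiplicative (ι →₀ ℤ) →* G :=
  have : IsMulCommutative (Subgroup.closure (Set.range t)) :=
    Subgroup.isMulCommutative_closure <| by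
      rintro _ ⟨i, rfl⟩ _ ⟨j, rfl⟩
      exact ht i j
  let multiples (i : ι) : ℤ →+ Additive (Subgroup.closure (Set.range t)) :=
    zmultiplesHom _ (Additive.ofMul ⟨t i, Subgroup.subset_closure ⟨i, rfl⟩⟩)
  (Subgroup.closure (Set.range t)).subtype.comp <|
    AddMonoidHom.toMultiplicativeLeft (Finsupp.liftAddHom multiples)

variable {t : ι → G} (ht : ∀ i j, Commute (t i) (t j))

theorem commutingLift_single (i : ι) (n : ℤ) :
    commutingLift t ht (Multiplicative.ofAdd (Finsupp.single i n)) = t i ^ n := by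
  simp [commutingLift]

theorem range_commutingLift :
    (commutingLift t ht).range = Subgroup.closure (Set.range t) := by
  refine le_antisymm ?_ ((Subgroup.closure_le _).2 ?_)
  · rintro _ ⟨v, rfl⟩
    exact SetLike.coe_mem (_ : Subgroup.closure (Set.range t))
  · rintro _ ⟨i, rfl⟩
    exact ⟨_, (commutingLift_single ht i 1).trans (zpow_one _)⟩

end CommutingFamily

theorem neg_one_zpow_smul_basis_eq_iff {ι K V : Type*} [DivisionRing K] [NeZero (2 : K)]
    [AddCommGroup V] [Module K V] (b : Module.Basis ι K V) {i j : ι} {n : ℤ} :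
    (-1 : K) ^ n • b i = b j ↔ i = j ∧ Even n := by
  have hneg : (-1 : K) ≠ 1 := by
    rw [Ne, neg_eq_iff_add_eq_zero, one_add_one_eq_two]
    exact two_ne_zero
  rw [neg_one_zpow_eq_ite, ← b.repr.injective.eq_iff, map_smul, b.repr_self, b.repr_self,
    Finsupp.smul_single_one, Finsupp.single_eq_single_iff]
  split_ifs with h <;> simp [h, hneg]

/-- The action of the permutations of `X` on `ℤ^X` by permutation of the coordinates. -/
noncomputable def permAction (X : Type*) :
    Equiv.Perm X →* MulAut (Multiplicative (X →₀ ℤ)) where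
  toFun σ := AddEquiv.toMultiplicative (Finsupp.domCongr σ)
  map_one' := by ext v x; rfl
  map_mul' σ τ := by ext v x; rfl

theorem permAction_single {X : Type*} (σ : Equiv.Perm X) (x : X) (n : ℤ) :
    permAction X σ (Multiplicative.ofAdd (Finsupp.single x n)) =
      Multiplicative.ofAdd (Finsupp.single (σ x) n) :=
  congrArg Multiplicative.ofAdd (Finsupp.equivMapDomain_single σ x n)

namespace Solution

variable {X : Type*} (s : Solution X)

theorem f_apply_g (x y : X) : fMap s.S (fMap s.S y x) (gMap s.S x y) = y :=
  congrArg Prod.snd (s.S_S (x, y))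

theorem g_apply_f (x y : X) : gMap s.S (gMap s.S x y) (fMap s.S y x) = x :=
  congrArg Prod.fst (s.S_S (x, y))

theorem phi_mul_phi (x y : X) :
    s.phi x * s.phi y = s.phi (gMap s.S x y) * s.phi (fMap s.S y x) :=
  Equiv.ext fun z => s.phi_comp_phi x y z

variable {s} in
theorem isFrozen_iff_g {x y : X} : s.IsFrozen x y ↔ gMap s.S x y = x := by
  refine ⟨fun h => congrArg Prod.fst h, fun h => Prod.ext h ?_⟩
  have h' := s.g_apply_f x y
  rw [h] at h'
  exact (s.bijective_g x).1 (h'.trans h.symm)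

variable {s} in
theorem isFrozen_iff_f {x y : X} : s.IsFrozen x y ↔ fMap s.S y x = y := by
  refine ⟨fun h => congrArg Prod.snd h, fun h => Prod.ext ?_ h⟩
  have h' := s.f_apply_g x y
  rw [h] at h'
  exact (s.bijective_f y).1 (h'.trans h.symm)

variable {s} in
theorem isFrozen_iff_phi {x y : X} : s.IsFrozen x y ↔ s.phi y y = x := by
  rw [isFrozen_iff_f, phi_eq_iff, eq_comm]

theorem bijective_phi_diag : Function.Bijective fun x => s.phi x x := by
  constructor
  · intro x y (h : s.phi x x = s.phi y y)
    have hx := isFrozen_iff_g.1 (isFrozen_iff_phi.2 h)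
    have hy := isFrozen_iff_g.1 (isFrozen_iff_phi.2 (Eq.refl (s.phi y y)))
    exact (s.bijective_g _).1 (hx.trans hy.symm)
  · intro x
    obtain ⟨y, hy⟩ := (s.bijective_g x).2 x
    exact ⟨y, isFrozen_iff_phi.1 (isFrozen_iff_g.2 hy)⟩

/-- The permutation `x ↦ φ_x x` of `X`; the frozen pairs are the pairs `(diag x, x)`. -/
noncomputable def diag : Equiv.Perm X :=
  Equiv.ofBijective _ s.bijective_phi_diag

theorem phi_self (x : X) : s.phi x x = s.diag x := rfl

theorem isFrozen_diag (x : X) : s.IsFrozen (s.diag x) x := isFrozen_iff_phi.2 rfl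

theorem phi_diag (x y : X) : s.phi x (s.diag y) = s.diag (gMap s.S x y) := by
  rw [← phi_self, ← phi_self, phi_comp_phi,
    (s.phi_eq_iff (gMap s.S x y) (fMap s.S y x) y).2 (s.f_apply_g x y).symm]

theorem gen_mul_gen (x y : X) :
    s.gen x * s.gen y = s.gen (gMap s.S x y) * s.gen (fMap s.S y x) := by
  by_cases h : s.S (x, y) = (x, y)
  · rw [show gMap s.S x y = x from congrArg Prod.fst h,
      show fMap s.S y x = y from congrArg Prod.snd h]
  · exact mul_inv_eq_one.1 (PresentedGroup.one_of_mem (rels := s.relators) ⟨x, y, h, rfl⟩)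

theorem gen_mul_gen_eq_of_phi_diag {x y x' y' : X} (hx : s.phi x (s.diag y) = s.diag x')
    (hx' : s.phi x' (s.diag y') = s.diag x) : s.gen x * s.gen y = s.gen x' * s.gen y' := by
  obtain rfl : gMap s.S x y = x' := s.diag.injective ((s.phi_diag x y).symm.trans hx)
  obtain rfl : fMap s.S y x = y' := by
    refine (s.bijective_g (gMap s.S x y)).1 ((s.g_apply_f x y).trans ?_)
    exact s.diag.injective (hx'.symm.trans (s.phi_diag _ _))
  exact s.gen_mul_gen x y

variable {s} in
theorem structureGroup_induction {p : s.StructureGroup → Prop} (gen : ∀ x, p (s.gen x))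
    (one : p 1) (mul : ∀ g h, p g → p h → p (g * h)) (inv : ∀ g, p g → p g⁻¹)
    (g : s.StructureGroup) : p g := by
  have hg : g ∈ Subgroup.closure (Set.range s.gen) :=
    (PresentedGroup.closure_range_of s.relators).symm ▸ Subgroup.mem_top g
  induction hg using Subgroup.closure_induction with
  | mem _ hx => obtain ⟨x, rfl⟩ := hx; exact gen x
  | one => exact one
  | mul g h _ _ hg hh => exact mul g h hg hh
  | inv g _ hg => exact inv g hg

/-- The affine transformation `v ↦ φ_x v + e_{φ_x x}` of `ℤ^X`, as an element of the semidirect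
product of the translations and the permutations of the coordinates. -/
noncomputable def affineGen (x : X) :
    Multiplicative (X →₀ ℤ) ⋊[permAction X] Equiv.Perm X :=
  ⟨Multiplicative.ofAdd (Finsupp.single (s.diag x) 1), s.phi x⟩

theorem affineGen_mul_affineGen (x y : X) :
    s.affineGen x * s.affineGen y =
      s.affineGen (gMap s.S x y) * s.affineGen (fMap s.S y x) := by
  apply SemidirectProduct.ext
  · simp only [affineGen, SemidirectProduct.mul_left, permAction_single, phi_diag, g_apply_f]
    exact mul_comm _ _
  · exact s.phi_mul_phi x y

/-- The action of the structure group on `ℤ^X` by affine transformations, in which `x : X` acts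
as `affineGen x`. -/
noncomputable def affine :
    s.StructureGroup →* Multiplicative (X →₀ ℤ) ⋊[permAction X] Equiv.Perm X :=
  PresentedGroup.toGroup (f := s.affineGen) <| by
    rintro _ ⟨x, y, -, rfl⟩
    simp only [map_mul, map_inv, FreeGroup.lift_apply_of]
    rw [affineGen_mul_affineGen, mul_inv_cancel]

theorem affine_gen (x : X) : s.affine (s.gen x) = s.affineGen x :=
  PresentedGroup.toGroup.of _

/-- The linear part of the affine action: the action of the structure group on `X` in which `x`
acts as `φ_x`. -/
noncomputable def perm : s.StructureGroup →* Equiv.Perm X :=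
  SemidirectProduct.rightHom.comp s.affine

theorem perm_gen (x : X) : s.perm (s.gen x) = s.phi x :=
  congrArg SemidirectProduct.right (s.affine_gen x)

theorem perm_inv_perm (g : s.StructureGroup) (x : X) : s.perm g⁻¹ (s.perm g x) = x := by
  rw [← Equiv.Perm.mul_apply, ← map_mul, inv_mul_cancel, map_one, Equiv.Perm.one_apply]

theorem perm_gen_inv_diag (x : X) : s.perm (s.gen x)⁻¹ (s.diag x) = x := by
  rw [← phi_self, ← perm_gen, perm_inv_perm]

/-- The translation part of the affine action, which is a 1-cocycle of the structure group with
values in `ℤ^X`. -/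
noncomputable def cocycle (g : s.StructureGroup) : X →₀ ℤ :=
  (s.affine g).left.toAdd

theorem cocycle_gen (x : X) : s.cocycle (s.gen x) = Finsupp.single (s.diag x) 1 :=
  congrArg (fun a => a.left.toAdd) (s.affine_gen x)

theorem cocycle_one : s.cocycle 1 = 0 :=
  congrArg (fun a => a.left.toAdd) (map_one s.affine)

theorem ofAdd_cocycle_mul (g h : s.StructureGroup) :
    Multiplicative.ofAdd (s.cocycle (g * h)) = Multiplicative.ofAdd (s.cocycle g) *
      permAction X (s.perm g) (Multiplicative.ofAdd (s.cocycle h)) :=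
  congrArg SemidirectProduct.left (map_mul s.affine g h)

theorem cocycle_mul_apply (g h : s.StructureGroup) (x : X) :
    s.cocycle (g * h) x = s.cocycle g x + s.cocycle h (s.perm g⁻¹ x) := by
  rw [map_inv]
  exact DFunLike.congr_fun (congrArg Multiplicative.toAdd (s.ofAdd_cocycle_mul g h)) x

/-- The permutation `g ↦ g x` of the structure group, where `x` is the generator for which the
cocycle of `g x` is that of `g` plus `e_y`: a lift of the translation of `ℤ^X` by `e_y`. -/
noncomputable def shift (y : X) : Equiv.Perm s.StructureGroup where
  toFun g := g * s.gen (s.diag.symm (s.perm g⁻¹ y))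
  invFun g := g * (s.gen (s.perm g⁻¹ y))⁻¹
  left_inv g := by
    obtain ⟨x, hx⟩ := s.diag.surjective (s.perm g⁻¹ y)
    simp only [← hx, Equiv.symm_apply_apply, mul_inv_rev, map_mul, Equiv.Perm.mul_apply,
      perm_gen_inv_diag, mul_inv_cancel_right]
  right_inv g := by
    simp only [mul_inv_rev, inv_inv, map_mul, Equiv.Perm.mul_apply, perm_gen, phi_self,
      Equiv.symm_apply_apply, inv_mul_cancel_right]

theorem shift_apply_of_perm_diag {g : s.StructureGroup} {x y : X}
    (h : s.perm g (s.diag x) = y) : s.shift y g = g * s.gen x := by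
  simp [shift, ← h]

theorem commute_shift (y z : X) : Commute (s.shift y) (s.shift z) := by
  ext g
  have exists_gen (h : s.StructureGroup) (y : X) : ∃ x, s.perm h (s.diag x) = y :=
    ((s.perm h).surjective.comp s.diag.surjective) y
  obtain ⟨u, hu⟩ := exists_gen g z
  obtain ⟨v, hv⟩ := exists_gen g y
  obtain ⟨u', hu'⟩ := exists_gen (g * s.gen u) y
  obtain ⟨v', hv'⟩ := exists_gen (g * s.gen v) z
  rw [Equiv.Perm.mul_apply, Equiv.Perm.mul_apply, s.shift_apply_of_perm_diag hu,
    s.shift_apply_of_perm_diag hv, s.shift_apply_of_perm_diag hu',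
    s.shift_apply_of_perm_diag hv', mul_assoc, mul_assoc]
  rw [map_mul, Equiv.Perm.mul_apply, perm_gen] at hu' hv'
  exact congrArg _ (s.gen_mul_gen_eq_of_phi_diag
    ((s.perm g).injective (hu'.trans hv.symm)) ((s.perm g).injective (hv'.trans hu.symm)))

theorem semiconjBy_mulLeft_shift (g : s.StructureGroup) (y : X) :
    SemiconjBy (Equiv.mulLeft g) (s.shift y) (s.shift (s.perm g y)) := by
  ext h
  have hperm : s.perm (g * h)⁻¹ (s.perm g y) = s.perm h⁻¹ y := by
    rw [mul_inv_rev, map_mul, Equiv.Perm.mul_apply, perm_inv_perm]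
  simp only [shift, Equiv.Perm.mul_apply, Equiv.coe_mulLeft, Equiv.coe_fn_mk, hperm, mul_assoc]

/-- The action of `ℤ^X` on the structure group in which `e_y` acts as `shift y`. -/
noncomputable def translate : Multiplicative (X →₀ ℤ) →* Equiv.Perm s.StructureGroup :=
  commutingLift s.shift s.commute_shift

theorem semiconjBy_mulLeft_translate (g : s.StructureGroup) (v : Multiplicative (X →₀ ℤ)) :
    SemiconjBy (Equiv.mulLeft g) (s.translate v)
      (s.translate (permAction X (s.perm g) v)) := by
  induction v using Multiplicative.rec with | ofAdd v
  induction v using Finsupp.induction_linear with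
  | zero => simp
  | add v w hv hw =>
    rw [ofAdd_add, map_mul, map_mul, map_mul]
    exact hv.mul_right hw
  | single y n =>
    rw [permAction_single, translate, commutingLift_single, commutingLift_single]
    exact (s.semiconjBy_mulLeft_shift g y).zpow_right n

theorem mul_translate_one (g : s.StructureGroup) (v : Multiplicative (X →₀ ℤ)) :
    g * s.translate v 1 = s.translate (permAction X (s.perm g) v) g := by
  simpa using Equiv.congr_fun (s.semiconjBy_mulLeft_translate g v) 1

theorem translate_cocycle_mul_one {g : s.StructureGroup}
    (hg : s.translate (Multiplicative.ofAdd (s.cocycle g)) 1 = g) (h : s.StructureGroup) :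
    s.translate (Multiplicative.ofAdd (s.cocycle (g * h))) 1 =
      g * s.translate (Multiplicative.ofAdd (s.cocycle h)) 1 := by
  rw [ofAdd_cocycle_mul, mul_comm, map_mul, Equiv.Perm.mul_apply, hg, mul_translate_one]

theorem translate_cocycle_one (g : s.StructureGroup) :
    s.translate (Multiplicative.ofAdd (s.cocycle g)) 1 = g := by
  induction g using structureGroup_induction with
  | gen x =>
    rw [cocycle_gen, translate, commutingLift_single, zpow_one,
      s.shift_apply_of_perm_diag (x := x) (by simp), one_mul]
  | one => simp [cocycle_one]
  | mul g h hg hh => rw [s.translate_cocycle_mul_one hg, hh]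
  | inv g hg =>
    refine eq_inv_of_mul_eq_one_right ?_
    rw [← s.translate_cocycle_mul_one hg, mul_inv_cancel]
    simp [cocycle_one]

theorem cocycle_injective : Function.Injective s.cocycle :=
  Function.LeftInverse.injective (g := fun v => s.translate (Multiplicative.ofAdd v) 1)
    s.translate_cocycle_one

theorem affine_injective : Function.Injective s.affine := fun _ _ h =>
  s.cocycle_injective (congrArg (fun a => a.left.toAdd) h)

section Representation

variable {V : Type*} [AddCommGroup V] [Module ℝ V] (b : Module.Basis X ℝ V)

theorem psi_apply_basis (g : s.StructureGroup) (x : X) :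
    s.psi b g (b x) = (-1 : ℝ) ^ s.cocycle g (s.perm g x) • b (s.perm g x) := by
  classical
  induction g using structureGroup_induction generalizing x with
  | gen y =>
    rw [psi_gen, psiGen_apply, perm_gen, cocycle_gen, ← phi_self]
    by_cases h : x = y
    · subst h; simp
    · simp [h]
  | one => simp [cocycle_one]
  | mul g h hg hh =>
    rw [map_mul, LinearEquiv.mul_apply, hh, map_smul, hg, smul_smul, cocycle_mul_apply,
      zpow_add₀ (by norm_num), mul_comm, map_mul, Equiv.Perm.mul_apply, perm_inv_perm]
  | inv g hg =>
    have hcocycle : s.cocycle g⁻¹ (s.perm g⁻¹ x) + s.cocycle g x = 0 := by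
      rw [add_comm, ← cocycle_mul_apply, mul_inv_cancel, cocycle_one, Finsupp.zero_apply]
    have hperm : s.perm g (s.perm g⁻¹ x) = x := by
      simpa only [inv_inv] using s.perm_inv_perm g⁻¹ x
    apply (s.psi b g).injective
    rw [← LinearEquiv.mul_apply, ← map_mul, mul_inv_cancel, map_one, LinearEquiv.coe_one,
      id_eq, map_smul, hg, smul_smul, hperm, ← zpow_add₀ (by norm_num), hcocycle, zpow_zero,
      one_smul]

theorem psi_eq_one_iff {g : s.StructureGroup} :
    s.psi b g = 1 ↔ s.perm g = 1 ∧ ∀ x, Even (s.cocycle g x) := by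
  constructor
  · intro h
    have hsign (x : X) : s.perm g x = x ∧ Even (s.cocycle g (s.perm g x)) := by
      rw [← neg_one_zpow_smul_basis_eq_iff b, ← psi_apply_basis, h, LinearEquiv.coe_one, id_eq]
    have hperm : s.perm g = 1 := Equiv.ext fun x => (hsign x).1
    exact ⟨hperm, fun x => by simpa only [(hsign x).1] using (hsign x).2⟩
  · rintro ⟨hperm, heven⟩
    refine LinearEquiv.toLinearMap_injective (b.ext fun x => ?_)
    simp [psi_apply_basis, hperm, (heven x).neg_one_zpow]

theorem mem_N_iff_exists_affine {g : s.StructureGroup} :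
    g ∈ s.N b ↔ ∃ v, s.affine g = SemidirectProduct.inl (v ^ 2) := by
  rw [N, psiW, MonoidHom.ker_rangeRestrict, MonoidHom.mem_ker, psi_eq_one_iff]
  constructor
  · rintro ⟨hperm, heven⟩
    have hcocycle : 2 • (s.cocycle g).mapRange (· / 2) rfl = s.cocycle g :=
      Finsupp.ext fun x => (nsmul_eq_mul _ _).trans (Int.two_mul_ediv_two_of_even (heven x))
    exact ⟨_, SemidirectProduct.ext (congrArg Multiplicative.ofAdd hcocycle.symm) hperm⟩
  · rintro ⟨v, hv⟩
    refine ⟨congrArg SemidirectProduct.right hv, fun x => ?_⟩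
    have hcocycle : s.cocycle g = 2 • v.toAdd := congrArg (fun a => a.left.toAdd) hv
    simp [hcocycle]

end Representation

/-- The frozen element whose cocycle is `2 e_y` when Property (C) holds. -/
noncomputable def frozen (y : X) : s.StructureGroup :=
  s.gen (s.diag.symm y) * s.gen (s.diag.symm (s.diag.symm y))

theorem frozenElements_eq_range : s.frozenElements = Set.range s.frozen := by
  ext a
  constructor
  · rintro ⟨x, y, h, rfl⟩
    obtain rfl : s.diag y = x := isFrozen_iff_phi.1 h
    exact ⟨s.diag (s.diag y), by simp only [frozen, Equiv.symm_apply_apply]⟩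
  · rintro ⟨y, rfl⟩
    exact ⟨_, _, isFrozen_iff_phi.2 (s.diag.apply_symm_apply _), rfl⟩

variable {s}

namespace PropertyC

theorem phi_mul_phi_eq_one (hC : s.PropertyC) {x y : X} (h : s.IsFrozen x y) :
    s.phi x * s.phi y = 1 := by
  ext z
  rw [Equiv.Perm.mul_apply, Equiv.Perm.one_apply, phi_eq_iff, phi_eq_iff]
  exact (congrFun (hC x y h).2 z).symm

theorem affine_frozen (hC : s.PropertyC) (y : X) :
    s.affine (s.frozen y) =
      SemidirectProduct.inl (Multiplicative.ofAdd (Finsupp.single y 2)) := by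
  obtain ⟨x, rfl⟩ := (s.diag.surjective.comp s.diag.surjective) y
  have hfrozen : s.frozen (s.diag (s.diag x)) = s.gen (s.diag x) * s.gen x := by
    simp only [frozen, Equiv.symm_apply_apply]
  rw [Function.comp_apply, hfrozen, map_mul, affine_gen, affine_gen]
  refine SemidirectProduct.ext ?_ (hC.phi_mul_phi_eq_one (s.isFrozen_diag x))
  simp only [affineGen, SemidirectProduct.mul_left, permAction_single, phi_self,
    SemidirectProduct.left_inl, ← ofAdd_add, ← Finsupp.single_add, one_add_one_eq_two]

theorem commute_frozen (hC : s.PropertyC) (y z : X) : Commute (s.frozen y) (s.frozen z) := by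
  refine s.affine_injective ?_
  rw [map_mul, map_mul, hC.affine_frozen, hC.affine_frozen]
  exact (Commute.all _ _).map _

/-- Under Property (C), the morphism from `ℤ^X` to the structure group that sends `e_y` to
`frozen y`. -/
noncomputable def frozenLift (hC : s.PropertyC) : Multiplicative (X →₀ ℤ) →* s.StructureGroup :=
  commutingLift s.frozen hC.commute_frozen

theorem range_frozenLift (hC : s.PropertyC) : hC.frozenLift.range = s.frozenSubgroup := by
  rw [frozenLift, range_commutingLift, frozenSubgroup, frozenElements_eq_range]

theorem affine_frozenLift (hC : s.PropertyC) (v : Multiplicative (X →₀ ℤ)) :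
    s.affine (hC.frozenLift v) = SemidirectProduct.inl (v ^ 2) := by
  suffices s.affine.comp hC.frozenLift = SemidirectProduct.inl.comp (powMonoidHom 2) from
    DFunLike.congr_fun this v
  refine Finsupp.mulHom_ext fun y n => ?_
  rw [MonoidHom.comp_apply, MonoidHom.comp_apply, frozenLift, commutingLift_single, map_zpow,
    hC.affine_frozen, ← map_zpow, powMonoidHom_apply, ← ofAdd_zsmul, ← ofAdd_nsmul,
    Finsupp.smul_single, Finsupp.smul_single, smul_eq_mul, nsmul_eq_mul, mul_comm,
    Nat.cast_ofNat]

theorem frozenLift_injective (hC : s.PropertyC) : Function.Injective hC.frozenLift := fun v w h =>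
  pow_left_injective two_ne_zero <| SemidirectProduct.inl_injective <| by
    rw [← hC.affine_frozenLift, ← hC.affine_frozenLift, h]

theorem frozen_injective (hC : s.PropertyC) : Function.Injective s.frozen := fun y z h =>
  Finsupp.single_left_injective (two_ne_zero (α := ℤ)) <| Multiplicative.ofAdd.injective <|
    SemidirectProduct.inl_injective <| by rw [← hC.affine_frozen, ← hC.affine_frozen, h]

theorem N_eq_frozenSubgroup (hC : s.PropertyC) {V : Type*} [AddCommGroup V] [Module ℝ V]
    (b : Module.Basis X ℝ V) : s.N b = s.frozenSubgroup := by
  ext g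
  simp only [mem_N_iff_exists_affine, ← hC.affine_frozenLift, s.affine_injective.eq_iff,
    ← hC.range_frozenLift, MonoidHom.mem_range, eq_comm]

/-- Under Property (C), the bijection from `X` to the set of frozen elements that sends `y` to
`frozen y`. -/
noncomputable def equivFrozenElements (hC : s.PropertyC) : X ≃ s.frozenElements :=
  (Equiv.ofInjective s.frozen hC.frozen_injective).trans
    (Equiv.setCongr s.frozenElements_eq_range.symm)

theorem coe_equivFrozenElements (hC : s.PropertyC) (y : X) :
    (hC.equivFrozenElements y : s.StructureGroup) = s.frozen y := rfl

/-- Under Property (C), the isomorphism from `ℤ^X` to the frozen subgroup given by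
`frozenLift`. -/
noncomputable def frozenEquiv (hC : s.PropertyC) : Multiplicative (X →₀ ℤ) ≃* s.frozenSubgroup :=
  (MonoidHom.ofInjective hC.frozenLift_injective).trans
    (MulEquiv.subgroupCongr hC.range_frozenLift)

theorem coe_frozenEquiv_single (hC : s.PropertyC) (y : X) :
    (hC.frozenEquiv (Multiplicative.ofAdd (Finsupp.single y 1)) : s.StructureGroup) =
      s.frozen y :=
  (commutingLift_single hC.commute_frozen y 1).trans (zpow_one _)

theorem exists_freeAbelianGroup_equiv_frozenSubgroup (hC : s.PropertyC) :
    ∃ e : Multiplicative (FreeAbelianGroup s.frozenElements) ≃* s.frozenSubgroup,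
      ∀ a : s.frozenElements,
        (e (Multiplicative.ofAdd (FreeAbelianGroup.of a)) : s.StructureGroup) = a := by
  let coordinates : FreeAbelianGroup s.frozenElements ≃+ (X →₀ ℤ) :=
    (FreeAbelianGroup.equivFinsupp _).trans (Finsupp.domCongr hC.equivFrozenElements.symm)
  refine ⟨coordinates.toMultiplicative.trans hC.frozenEquiv, fun a => ?_⟩
  obtain ⟨y, rfl⟩ := hC.equivFrozenElements.surjective a
  have hcoordinates : coordinates (FreeAbelianGroup.of (hC.equivFrozenElements y)) =
      Finsupp.single y 1 := by
    simp [coordinates]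
  rw [coe_equivFrozenElements, ← coe_frozenEquiv_single, ← hcoordinates]
  rfl

end PropertyC

end Solution

end YangBaxter

theorem mainTheorem3_general {X : Type*} (s : YangBaxter.Solution X)
    {V : Type*} [AddCommGroup V] [Module ℝ V] (b : Module.Basis X ℝ V)
    (hC : s.PropertyC) :
    s.N b = s.frozenSubgroup ∧
    Nonempty (X ≃ s.frozenElements) ∧
    (∃ e : Multiplicative (FreeAbelianGroup s.frozenElements) ≃* s.frozenSubgroup,
      ∀ a : s.frozenElements,
        (e (Multiplicative.ofAdd (FreeAbelianGroup.of a)) : s.StructureGroup) = a) ∧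
    Nonempty (s.frozenSubgroup ≃* Multiplicative (X →₀ ℤ)) ∧
    (Function.Injective (s.N b).subtype ∧
      (s.N b).subtype.range = (s.psiW b).ker ∧
      Function.Surjective (s.psiW b)) :=
  ⟨hC.N_eq_frozenSubgroup b, ⟨hC.equivFrozenElements⟩,
    hC.exists_freeAbelianGroup_equiv_frozenSubgroup, ⟨hC.frozenEquiv.symm⟩,
    (s.N b).subtype_injective, (s.N b).range_subtype, (s.psi b).rangeRestrict_surjective⟩

theorem mainTheorem3 {X : Type*} [Finite X] (s : YangBaxter.Solution X)
    {V : Type*} [AddCommGroup V] [Module ℝ V] (b : Module.Basis X ℝ V)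
    (hC : s.PropertyC) :
    -- the kernel of `ψ` is the frozen subgroup
    s.N b = s.frozenSubgroup ∧
    -- there are exactly `n` frozen elements
    s.frozenElements.ncard = Nat.card X ∧
    -- the frozen subgroup is free abelian, freely generated by the frozen elements
    (∃ e : Multiplicative (FreeAbelianGroup s.frozenElements) ≃* s.frozenSubgroup,
      ∀ a : s.frozenElements,
        (e (Multiplicative.ofAdd (FreeAbelianGroup.of a)) : s.StructureGroup) = a) ∧
    -- its rank is `n`
    Nonempty (s.frozenSubgroup ≃* Multiplicative (Fin (Nat.card X) → ℤ)) ∧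
    -- the sequence `1 → N(X, S) → G(X, S) → W(X, S) → 1` is exact
    (Function.Injective (s.N b).subtype ∧
      (s.N b).subtype.range = (s.psiW b).ker ∧
      Function.Surjective (s.psiW b)) := by
  obtain ⟨hN, ⟨elements⟩, hfree, ⟨coordinates⟩, hexact⟩ := mainTheorem3_general s b hC
  refine ⟨hN, (Nat.card_congr elements).symm, hfree, ⟨coordinates.trans ?_⟩, hexact⟩
  exact ((Finsupp.domCongr (Finite.equivFin X)).trans Finsupp.addEquivFunOnFinite).toMultiplicative
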